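/- **Definitions.** A $c$-arborization ($c>0$) of a graph $G$ is a finite family of forests $F\subseteq G$ with positive weights $w(F)$ such that every edge of $G$ lies in forests of total weight at least $1$ and $\sum_F w(F)=c$. The fractional arboricity of $G$ is $a_f(G)=\max_S \frac{m_S}{n_S-1}$, over the subgraphs $S$ of $G$ with $n_S\ge 2$ vertices ($m_S$ is the number of edges of $S$). **The graph $G_\ell^k$ ($k,\ell\ge 1$).** A square is a $4$-cycle with corners NW, NE, SE, SW. Start with an outer square and, inside it, nested one inside the other, the blocks $A_1,\dots,A_\ell$. Each $A_i$ consists of $k$ nested squares, its layers $k-1,\dots,0$ from the outside to the inside, where equal corners of consecutive layers are joined by an edge (a spoke). The block $S$ consists of the outer square and four spokes joining it to layer $k-1$ of $A_1$ (8 edges). For $1\le i<\ell$, the block $B_i$ joins layer $0$ of $A_i$ (its outer square) to layer $k-1$ of $A_{i+1}$ (its inner square) by 8 edges: plain spokes at NW and NE; at SE and at SW a spoke subdivided once, hence with an outer half and an inner half; and a further vertex $r$ of degree two joined to the SE and SW corners of the inner square. **The colouring of half-edges.** Colour the outer square blue, red, green, black at NW, NE, SE, SW; going inwards through all squares, alternate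 green-black-blue-red and blue-red-green-black (same order of corners). All half-edges at a corner of a square receive its colour. In $B_i$, at each of the three vertices of degree two, the two half-edges receive the two colours not used at the other ends of its two edges, in either order, so that its two edges carry all four colours. Let $E_c$ be the set of edges with a half-edge of colour $c$. **Special edges and labels.** Each edge of $S$ is special for one colour that does not occur on its half-edges, each colour having exactly two special edges in $S$. Write $o(X)$ and $\iota(X)$ for the colours of corner $X$ in the outer and inner square of $B_i$. In $B_i$, the plain spoke at NW is special for $o(\mathrm{NE})$ and that at NE for $o(\mathrm{NW})$; the inner half at SE for $o(\mathrm{SE})$ and that at SW for $o(\mathrm{SW})$; the outer half at SE for $\iota(\mathrm{SE})$ and that at SW for $\iota(\mathrm{SW})$ (or these last two exchanged, allowed only if neither outer half carries the colour for which it then is special); and of the two edges at $r$, the one whose half-edge at $r$ has colour $o(\mathrm{SE})$ is special for $o(\mathrm{SW})$, and conversely. The edges of $B_i$ are matched bijectively with the edges of $S$ (equal labels $S_1,\dots,S_8$), matched edges being special for the same colour. The choices in $B_i$ (orders at the degree-two vertices, exchange, matching) depend only on which of its two colourings the outer square of $B_i$ has. **The family $\mathcal A$.** Identify each edge of $B_i$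 with its match in $S$, and each edge of $A_i$ with the edge of $A_1$ at the same place if $A_i$ is coloured like $A_1$, and at the centrally reflected place otherwise. For a colour $c$ and an edge $x$ which is either an edge of $A_1$ not in $E_c$ or an edge of $S$ special for $c$, let $T_{c,x}$ consist of $E_c$ together with all edges identified with $x$ (including $x$). Its weight is $w(T_{c,x})=\frac1{8k+6}$ if $x$ is in $A_1$ and $\frac2{8k+6}$ if $x$ is in $S$. Let $\mathcal A$ be the weighted family of all $T_{c,x}$. **Proposition.** Let $k,\ell\ge 1$ and $g=8k+4$. For all choices as above, every $T_{c,x}$ is a spanning tree of $G_\ell^k$, and $\mathcal A$ is a $\frac{16k+8}{8k+6}$-arborization of $G_\ell^k$. Moreover $a_f(G_\ell^k)=\frac{2g}{g+2}$. -/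

import Mathlib

open scoped Classical in
/-- `F` (with weights `w`) is a `c`-arborization of `G`: a finite weighted family of forests of `G`
with positive weights, covering every edge with total weight at least `1`, of total weight `c`.
A forest, being determined by its edges, is given as a spanning subgraph. -/
structure IsArborization {V ι : Type*} [Fintype ι] (G : SimpleGraph V) (c : ℝ)
    (F : ι → SimpleGraph V) (w : ι → ℝ) : Prop where
  pos : 0 < c
  weight_pos : ∀ i, 0 < w i
  le : ∀ i, F i ≤ G
  acyclic : ∀ i, (F i).IsAcyclic
  cover : ∀ e ∈ G.edgeSet, 1 ≤ ∑ i with e ∈ (F i).edgeSet, w i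
  total : ∑ i, w i = c

/-- `a` is the fractional arboricity of `G`: the maximum of `m_S / (n_S - 1)` over the subgraphs
`S` of `G` with at least two vertices. -/
def IsFractionalArboricity {V : Type*} (G : SimpleGraph V) (a : ℝ) : Prop :=
  IsGreatest {x : ℝ | ∃ S : G.Subgraph, 2 ≤ S.verts.ncard ∧
    x = (S.edgeSet.ncard : ℝ) / ((S.verts.ncard : ℝ) - 1)} a

namespace Skeleton

/-- The corners of a square, clockwise: `0` is North-West, `1` is North-East, `2` is South-East,
`3` is South-West. Hence `c + 1` is the next corner and `c + 2` the opposite one. -/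
abbrev Corner := Fin 4

inductive North
  | nw | ne
  deriving DecidableEq

instance : Fintype North :=
  ⟨{.nw, .ne}, by intro x; cases x <;> decide⟩

inductive South
  | se | sw
  deriving DecidableEq

instance : Fintype South :=
  ⟨{.se, .sw}, by intro x; cases x <;> decide⟩

def North.corner : North → Corner
  | .nw => 0
  | .ne => 1

def North.other : North → North
  | .nw => .ne
  | .ne => .nw

def South.corner : South → Corner
  | .se => 2
  | .sw => 3

def South.other : South → South
  | .se => .sw
  | .sw => .se

/-! ### The graph -/

/-- Edges added by the starting block: the sides of the outer square, and the spokes joining it to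
layer `k - 1` of the first block `A`. -/
inductive SEdge
  | side (c : Corner)
  | spoke (c : Corner)
  deriving DecidableEq, Fintype

/-- Edges of a block `A` with layers `0, …, k - 1`: `side j c` is the side of layer `j` from corner
`c` to corner `c + 1`; `spoke j c` joins the corners `c` of layers `j + 1` and `j`. -/
inductive AEdge (k : ℕ)
  | side (j : Fin k) (c : Corner)
  | spoke (j : Fin (k - 1)) (c : Corner)
  deriving DecidableEq, Fintype

/-- Edges added by a block `B`: two plain spokes in the North, two subdivided spokes in the South
(each consisting of an outer and an inner half), and the two edges joining the extra vertex of
degree two to the two South corners of the inner square. -/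
inductive BEdge
  | plain (n : North)
  | outerHalf (s : South)
  | innerHalf (s : South)
  | extra (s : South)
  deriving DecidableEq, Fintype

/-- Vertices of the graph with `ℓ` blocks `A`, each with `k` layers. The blocks `A` are indexed by
`i = 0, …, ℓ - 1` from the outside to the inside, and the block `B` with index `i` lies between the
blocks `A` with indices `i` and `i + 1`. -/
inductive Vert (k ℓ : ℕ)
  | outer (c : Corner)
  | layer (i : Fin ℓ) (j : Fin k) (c : Corner)
  | mid (i : Fin (ℓ - 1)) (s : South)
  | extra (i : Fin (ℓ - 1))
  deriving DecidableEq, Fintype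

inductive Edge (k ℓ : ℕ)
  | inS (e : SEdge)
  | inA (i : Fin ℓ) (e : AEdge k)
  | inB (i : Fin (ℓ - 1)) (e : BEdge)
  deriving DecidableEq, Fintype

section
variable {k ℓ : ℕ} [NeZero k] [NeZero ℓ]

/-- Corner `c` of layer `k - 1` (the outermost one) of the `i`-th block `A`. -/
def outermost (i : Fin ℓ) (c : Corner) : Vert k ℓ :=
  .layer i ⟨k - 1, Nat.sub_one_lt (NeZero.ne k)⟩ c

/-- Corner `c` of layer `0` (the innermost one) of the `i`-th block `A`. -/
def innermost (i : Fin ℓ) (c : Corner) : Vert k ℓ :=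
  .layer i ⟨0, Nat.pos_of_ne_zero (NeZero.ne k)⟩ c

/-- The block `A` just outside the `i`-th block `B`. -/
def before (i : Fin (ℓ - 1)) : Fin ℓ := ⟨i, by omega⟩

/-- The block `A` just inside the `i`-th block `B`. -/
def after (i : Fin (ℓ - 1)) : Fin ℓ := ⟨i + 1, by omega⟩

/-- The two ends of an edge. A half-edge is a pair of an edge and a Boolean. -/
def Edge.endpoint : Edge k ℓ → Bool → Vert k ℓ
  | .inS (.side c), b => .outer (bif b then c + 1 else c)
  | .inS (.spoke c), b => bif b then outermost ⟨0, Nat.pos_of_ne_zero (NeZero.ne ℓ)⟩ c else .outer c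
  | .inA i (.side j c), b => .layer i j (bif b then c + 1 else c)
  | .inA i (.spoke j c), b =>
      bif b then .layer i ⟨j, by omega⟩ c else .layer i ⟨j + 1, by omega⟩ c
  | .inB i (.plain n), b =>
      bif b then outermost (after i) n.corner else innermost (before i) n.corner
  | .inB i (.outerHalf s), b => bif b then .mid i s else innermost (before i) s.corner
  | .inB i (.innerHalf s), b => bif b then outermost (after i) s.corner else .mid i s
  | .inB i (.extra s), b => bif b then outermost (after i) s.corner else .extra i

/-- The spanning subgraph with a given set of edges. -/
def spanningGraph (X : Set (Edge k ℓ)) : SimpleGraph (Vert k ℓ) :=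
  SimpleGraph.fromEdgeSet ((fun e => s(e.endpoint false, e.endpoint true)) '' X)

end

/-- The skeleton graph with `ℓ` blocks `A`, each with `k` layers. -/
def graph (k ℓ : ℕ) [NeZero k] [NeZero ℓ] : SimpleGraph (Vert k ℓ) :=
  spanningGraph Set.univ

/-! ### The colouring of the half-edges -/

inductive Colour
  | blue | red | green | black
  deriving DecidableEq

instance : Fintype Colour :=
  ⟨{.blue, .red, .green, .black}, by intro x; cases x <;> decide⟩

/-- The two colourings of the corners of a square: blue-red-green-black for `false`,
green-black-blue-red for `true`, clockwise from the North-West corner. -/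
def square (p : Bool) (c : Corner) : Colour :=
  (![.blue, .red, .green, .black] : Fin 4 → Colour) (bif p then c + 2 else c)

/-- The choices left in the colouring of a block `B`. Each of its three vertices of degree two sees
each of the four colours exactly once on its two edges, which leaves two choices at each of them;
`swap` exchanges the special colours of the outer halves of the two subdivided spokes, which is
possible only for one of the colourings at the subdivision vertices. -/
structure BChoice where
  mid : South → Bool
  extra : Bool
  swap : Bool
  mid_of_swap : swap = true → ∀ s, mid s = true

/-- Colours of the half-edges of a block `B` with outer square `square p` and inner square
`square !p`. -/
def BChoice.halfColour (D : BChoice) (p : Bool) : BEdge → Bool → Colour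
  | .plain n, b => square (bif b then !p else p) n.corner
  | .outerHalf s, b =>
      bif b then square (bif D.mid s then p else !p) s.other.corner else square p s.corner
  | .innerHalf s, b =>
      bif b then square (!p) s.corner else square (bif D.mid s then !p else p) s.other.corner
  | .extra s, b =>
      bif b then square (!p) s.corner
      else square p (bif D.extra then s.corner else s.other.corner)

/-- The colour for which an edge of a block `B` with outer square `square p` is special. -/
def BChoice.special (D : BChoice) (p : Bool) : BEdge → Colour
  | .plain n => square p n.other.corner
  | .outerHalf s => square (!p) (bif D.swap then s.other.corner else s.corner)
  | .innerHalf s => square p s.corner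
  | .extra s => square p (bif D.extra then s.other.corner else s.corner)

/-- Colours of the half-edges of the starting block. -/
def SEdge.halfColour : SEdge → Bool → Colour
  | .side c, b => square false (bif b then c + 1 else c)
  | .spoke c, b => square b c

/-- The data of the colouring and of the labels `S₁, …, S₈`: the choices in the two possible
colourings of a block `B` (according to the colouring of its outer square); the colour for which
each edge of the starting block is special, which is not one of the colours of that edge, there
being two special edges for each colour; and the matching, by equal labels, of the edges of a block
`B` with the edges of the starting block, in which matched edges are special for the same colour. -/
structure Labelling where
  choice : Bool → BChoice
  special : SEdge → Colour
  special_ne : ∀ e b, special e ≠ e.halfColour b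
  special_two : ∀ c, Fintype.card {e // special e = c} = 2
  label : Bool → BEdge ≃ SEdge
  special_label : ∀ p e, special (label p e) = (choice p).special p e

/-- Labellings exist. -/
theorem labelling_nonempty : Nonempty Labelling := by
  let sp : SEdge → Colour
    | .side c => (![.green, .black, .blue, .red] : Fin 4 → Colour) c
    | .spoke c => (![.red, .blue, .black, .green] : Fin 4 → Colour) c
  let refl : Bool → SEdge → SEdge
    | p, .side c => .side (bif p then c + 2 else c)
    | p, .spoke c => .spoke (bif p then c + 2 else c)
  let lab : Bool → BEdge → SEdge := fun p e => refl p (match e with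
    | .plain .nw => .side 3
    | .plain .ne => .side 2
    | .outerHalf .sw => .spoke 0
    | .outerHalf .se => .spoke 1
    | .innerHalf .se => .side 0
    | .innerHalf .sw => .side 1
    | .extra .se => .spoke 3
    | .extra .sw => .spoke 2)
  have hlab : ∀ p, Function.Bijective (lab p) := by decide
  let ch : BChoice := ⟨fun _ => false, false, false, by decide⟩
  have hsp : ∀ p e, sp (lab p e) = ch.special p e := by decide
  exact ⟨⟨fun _ => ch, sp, by decide, by decide, fun p => Equiv.ofBijective _ (hlab p),
    hsp⟩⟩

section
variable {k ℓ : ℕ}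

/-- The colouring of layer `j` of the `i`-th block `A`. The squares alternate from the outside to
the inside, starting with `square false` on the outer face and `square true` on the outermost
layer of the block with index `0`. -/
def parity (i : Fin ℓ) (j : Fin k) : Bool := Nat.bodd (i * k + (k - j))

/-- The colouring of layer `0` of the block `A` just outside the `i`-th block `B`. -/
def parityB (k : ℕ) (i : Fin (ℓ - 1)) : Bool := Nat.bodd ((i + 1) * k)

/-- The colours of the half-edges of the graph. -/
def Labelling.halfColour (D : Labelling) : Edge k ℓ → Bool → Colour
  | .inS e, b => e.halfColour b
  | .inA i (.side j c), b => square (parity i j) (bif b then c + 1 else c)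
  | .inA i (.spoke j c), b =>
      square (bif b then parity i (⟨j, by omega⟩ : Fin k)
        else parity i (⟨j + 1, by omega⟩ : Fin k)) c
  | .inB i e, b => (D.choice (parityB k i)).halfColour (parityB k i) e b

/-- The set `E_c` of the edges having a half-edge of colour `c`. -/
def Labelling.edgesOf (D : Labelling) (c : Colour) : Set (Edge k ℓ) :=
  {e | ∃ b, D.halfColour e b = c}

/-- Central reflection of a block `A`. -/
def AEdge.reflect : AEdge k → AEdge k
  | .side j c => .side j (c + 2)
  | .spoke j c => .spoke j (c + 2)

/-- The edge of the starting block or of the block `A` with index `0` with which an edge is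
identified. The coloured block `A` with index `i` is identical to the one with index `0` if `i * k`
is even, and to its central reflection otherwise. -/
def Labelling.identify (D : Labelling) : Edge k ℓ → SEdge ⊕ AEdge k
  | .inS e => .inl e
  | .inA i e => .inr (bif Nat.bodd (i * k) then e.reflect else e)
  | .inB i e => .inl (D.label (parityB k i) e)

/-- Whether the edge `x` is admissible for the colour `c`: `x` is an edge of the starting block that
is special for `c`, or an edge of the block `A` with index `0` that is not in `E_c`. -/
def Labelling.Admissible (D : Labelling) (ℓ : ℕ) [NeZero ℓ] (c : Colour) : SEdge ⊕ AEdge k → Prop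
  | .inl e => D.special e = c
  | .inr e =>
      Edge.inA (⟨0, Nat.pos_of_ne_zero (NeZero.ne ℓ)⟩ : Fin ℓ) e ∉ D.edgesOf c

/-- The indices `(c, x)` of the family of trees. -/
abbrev Labelling.Index (D : Labelling) (k ℓ : ℕ) [NeZero ℓ] : Type :=
  {t : Colour × (SEdge ⊕ AEdge k) // D.Admissible ℓ t.1 t.2}

noncomputable instance (D : Labelling) (k ℓ : ℕ) [NeZero ℓ] : Fintype (D.Index k ℓ) :=
  Fintype.ofFinite _

/-- The tree `T_{c,x}`: the forest `E_c` together with all the edges identified with `x`. -/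
def Labelling.tree (D : Labelling) (k ℓ : ℕ) [NeZero k] [NeZero ℓ] (t : D.Index k ℓ) :
    SimpleGraph (Vert k ℓ) :=
  spanningGraph (D.edgesOf t.1.1 ∪ {e | D.identify e = t.1.2})

/-- The weight of `T_{c,x}`. -/
noncomputable def Labelling.weight (D : Labelling) (k ℓ : ℕ) [NeZero ℓ] (t : D.Index k ℓ) : ℝ :=
  match t.1.2 with
  | .inl _ => 2 / (8 * (k : ℝ) + 6)
  | .inr _ => 1 / (8 * (k : ℝ) + 6)

end

end Skeleton

/-! Being a tree reduces to connectedness by counting: there are `ℓ * (4 * k + 3) + 1` vertices,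
`E_c` has `ℓ * (4 * k + 2)` edges, and at most `ℓ` edges are identified with `x`. Within a block
`A`, `E_c` consists of two trees, and every other edge of the block joins them. Once these trees are
contracted, connectedness across `S` and across one `B` is a finite check (`SEdge.connects`,
`BChoice.connects`), and it spreads inwards block by block (`tree_connected`).

Put `N = 8 * k + 6`. The trees of one colour weigh `(4 * k + 2) / N` together. An edge has two
colours and so receives `(8 * k + 4) / N` from the trees of these colours. The missing `2 / N` comes
from the tree of its special colour if it lies in `S` or some `B`, and from two trees of weight `1 /
N`, one for each remaining colour, if it lies in some `A` (`one_le_sum_weight`).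

A forest has at most `n_S - 1` edges in `S`, so the weight of an arborization bounds the fractional
arboricity from above. The whole graph attains this bound. -/

/-! ### Forests, arborizations and density -/

theorem SimpleGraph.IsAcyclic.ncard_edgeSet_add_one_le {V : Type*} [Finite V] [Nonempty V]
    {H : SimpleGraph V} (h : H.IsAcyclic) : H.edgeSet.ncard + 1 ≤ Nat.card V := by
  -- The forest extends to a spanning tree of the complete graph.
  obtain ⟨T, hle, -, hT⟩ :=
    SimpleGraph.connected_top.exists_isTree_le_of_le_of_isAcyclic (le_top : H ≤ ⊤) h
  have h1 := (SimpleGraph.isTree_iff_connected_and_card.1 hT).2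
  have h2 : H.edgeSet.ncard ≤ T.edgeSet.ncard :=
    Set.ncard_le_ncard (SimpleGraph.edgeSet_mono hle) (Set.toFinite _)
  rw [← Nat.card_coe_set_eq T.edgeSet] at h2
  omega

/-- The common edges form a forest on `S.verts`; inducing on this set discards the other vertices
from the count. -/
theorem SimpleGraph.Subgraph.ncard_edgeSet_inter_add_one_le {V : Type*} [Finite V]
    {G F : SimpleGraph V} (S : G.Subgraph) (hS : S.verts.Nonempty) (hF : F.IsAcyclic) :
    (S.edgeSet ∩ F.edgeSet).ncard + 1 ≤ S.verts.ncard := by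
  have : Nonempty S.verts := hS.to_subtype
  have hH : ((S.spanningCoe ⊓ F).induce S.verts).IsAcyclic := (hF.anti inf_le_right).induce _
  have h1 := hH.ncard_edgeSet_add_one_le
  rw [Nat.card_coe_set_eq] at h1
  refine le_trans (Nat.add_le_add_right ?_ 1) h1
  refine le_trans (Set.ncard_le_ncard (t := Sym2.map Subtype.val ''
    ((S.spanningCoe ⊓ F).induce S.verts).edgeSet) ?_ (Set.toFinite _))
    (Set.ncard_image_le (Set.toFinite _))
  intro e
  induction e using Sym2.ind with
  | _ u v =>
    rintro ⟨h, h'⟩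
    rw [SimpleGraph.Subgraph.mem_edgeSet] at h
    exact ⟨s(⟨u, S.edge_vert h⟩, ⟨v, S.edge_vert h.symm⟩), ⟨h, h'⟩, rfl⟩

/-- The total weight of an arborization bounds the density of every subgraph. -/
theorem IsArborization.ncard_edgeSet_le {V ι : Type*} [Finite V] [Fintype ι] {G : SimpleGraph V}
    {c : ℝ} {F : ι → SimpleGraph V} {w : ι → ℝ} (h : IsArborization G c F w) (S : G.Subgraph)
    (hS : S.verts.Nonempty) : (S.edgeSet.ncard : ℝ) ≤ c * ((S.verts.ncard : ℝ) - 1) := by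
  classical
  have hfin : S.edgeSet.Finite := Set.toFinite _
  calc (S.edgeSet.ncard : ℝ) = ∑ e ∈ hfin.toFinset, (1 : ℝ) := by
        rw [Set.ncard_eq_toFinset_card _ hfin]; simp
    _ ≤ ∑ e ∈ hfin.toFinset, ∑ i, if e ∈ (F i).edgeSet then w i else 0 := by
        refine Finset.sum_le_sum fun e he => ?_
        have := h.cover e (S.edgeSet_subset (hfin.mem_toFinset.1 he))
        rw [Finset.sum_filter] at this
        convert this
    _ = ∑ i, ∑ e ∈ hfin.toFinset, if e ∈ (F i).edgeSet then w i else 0 := Finset.sum_comm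
    _ ≤ ∑ i, w i * ((S.verts.ncard : ℝ) - 1) := by
        refine Finset.sum_le_sum fun i _ => ?_
        rw [← Finset.sum_filter, Finset.sum_const, nsmul_eq_mul, mul_comm]
        refine mul_le_mul_of_nonneg_left ?_ (h.weight_pos i).le
        have h1 := S.ncard_edgeSet_inter_add_one_le hS (h.acyclic i)
        have h2 : (S.edgeSet ∩ (F i).edgeSet).ncard
            = (hfin.toFinset.filter (· ∈ (F i).edgeSet)).card := by
          rw [← Set.ncard_coe_finset]
          congr 1
          ext e
          simp
        rw [h2] at h1
        have h3 : (((hfin.toFinset.filter (· ∈ (F i).edgeSet)).card : ℝ) + 1)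
          ≤ S.verts.ncard := by exact_mod_cast h1
        linarith
    _ = c * ((S.verts.ncard : ℝ) - 1) := by rw [← Finset.sum_mul, h.total]

/-- A spanning subgraph is connected if every two-colouring of the vertices that is constant along
its edges is constant. -/
theorem SimpleGraph.connected_of_forall_bool {V : Type*} {T : SimpleGraph V} (o : V)
    (h : ∀ P : V → Bool, (∀ u v, T.Adj u v → P u = P v) → P o = true → ∀ v, P v = true) :
    T.Connected := by
  classical
  refine SimpleGraph.connected_iff_exists_forall_reachable _ |>.2 ⟨o, fun v => ?_⟩
  -- The two-colouring is the indicator of the component of `o`.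
  have := h (fun v => decide (T.Reachable o v)) (fun a b hab => ?_) (by simp) v
  · simpa using this
  · have : T.Reachable o a ↔ T.Reachable o b :=
      ⟨fun h => h.trans hab.reachable, fun h => h.trans hab.symm.reachable⟩
    simp [this]

/-! ### Counting vertices and edges -/

namespace Skeleton

section
variable {k ℓ : ℕ}

/-- The edges of a block `A`, by kind. -/
def AEdge.equivSum (k : ℕ) : AEdge k ≃ (Fin k × Corner) ⊕ (Fin (k - 1) × Corner) where
  toFun
    | .side j c => .inl (j, c)
    | .spoke j c => .inr (j, c)
  invFun := Sum.elim (fun x => .side x.1 x.2) (fun x => .spoke x.1 x.2)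
  left_inv := by rintro (_ | _) <;> rfl
  right_inv := by rintro (_ | _) <;> rfl

theorem AEdge.sum_eq {M : Type*} [AddCommMonoid M] (f : AEdge k → M) :
    ∑ e, f e = (∑ j, ∑ c, f (.side j c)) + ∑ j, ∑ c, f (.spoke j c) := by
  rw [← (AEdge.equivSum k).symm.sum_comp, Fintype.sum_sum_type, Fintype.sum_prod_type,
    Fintype.sum_prod_type]
  rfl

/-- The edges of the graph, by block. -/
def Edge.equivSum (k ℓ : ℕ) :
    Edge k ℓ ≃ SEdge ⊕ (Fin ℓ × AEdge k) ⊕ (Fin (ℓ - 1) × BEdge) where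
  toFun
    | .inS e => .inl e
    | .inA i e => .inr (.inl (i, e))
    | .inB i e => .inr (.inr (i, e))
  invFun := Sum.elim .inS (Sum.elim (fun x => .inA x.1 x.2) (fun x => .inB x.1 x.2))
  left_inv := by rintro (_ | _ | _) <;> rfl
  right_inv := by rintro (_ | _ | _) <;> rfl

theorem Edge.sum_eq {M : Type*} [AddCommMonoid M] (f : Edge k ℓ → M) :
    ∑ e, f e = (∑ e, f (.inS e)) + ((∑ i, ∑ e, f (.inA i e)) + ∑ i, ∑ e, f (.inB i e)) := by
  rw [← (Edge.equivSum k ℓ).symm.sum_comp, Fintype.sum_sum_type, Fintype.sum_sum_type,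
    Fintype.sum_prod_type, Fintype.sum_prod_type]
  rfl

/-- The vertices of the graph, by kind. -/
def Vert.equivSum (k ℓ : ℕ) :
    Vert k ℓ ≃ Corner ⊕ (Fin ℓ × Fin k × Corner) ⊕ (Fin (ℓ - 1) × South) ⊕ Fin (ℓ - 1) where
  toFun
    | .outer c => .inl c
    | .layer i j c => .inr (.inl (i, j, c))
    | .mid i s => .inr (.inr (.inl (i, s)))
    | .extra i => .inr (.inr (.inr i))
  invFun := Sum.elim .outer (Sum.elim (fun x => .layer x.1 x.2.1 x.2.2)
    (Sum.elim (fun x => .mid x.1 x.2) .extra))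
  left_inv := by rintro (_ | _ | _ | _) <;> rfl
  right_inv := by rintro (_ | _ | _ | _) <;> rfl

theorem Vert.card_eq [NeZero ℓ] : Nat.card (Vert k ℓ) = ℓ * (4 * k + 3) + 1 := by
  obtain ⟨m, rfl⟩ := Nat.exists_eq_succ_of_ne_zero (NeZero.ne ℓ)
  have h : Fintype.card South = 2 := rfl
  rw [Nat.card_eq_fintype_card, Fintype.card_congr (Vert.equivSum k _)]
  simp [h]
  ring

variable [NeZero k] [NeZero ℓ]

/-- The pair of ends of an edge. -/
def Edge.ends (e : Edge k ℓ) : Sym2 (Vert k ℓ) := s(e.endpoint false, e.endpoint true)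

theorem North.corner_injective : Function.Injective North.corner := by decide
theorem South.corner_injective : Function.Injective South.corner := by decide

/-- There are no parallel edges, so the edges of the simple graph can be counted in `Edge k ℓ`. -/
theorem Edge.ends_injective : Function.Injective (Edge.ends : Edge k ℓ → _) := by
  have hc : ∀ c c' : Corner, c = c' + 1 → c + 1 = c' → False := by decide
  have hns : ∀ (n : North) (s : South), n.corner ≠ s.corner := by decide
  have hsn : ∀ (n : North) (s : South), s.corner ≠ n.corner := by decide
  rintro ((c | c) | ⟨i, (⟨j, c⟩ | ⟨j, c⟩)⟩ | ⟨i, (n | s | s | s)⟩)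
    ((c' | c') | ⟨i', (⟨j', c'⟩ | ⟨j', c'⟩)⟩ | ⟨i', (n' | s' | s' | s')⟩) h <;>
  simp [Edge.ends, Edge.endpoint, outermost, innermost, before, after, North.corner_injective.eq_iff, South.corner_injective.eq_iff,
    hns, hsn] at h ⊢ <;>
  grind [Fin.ext_iff]

theorem Edge.endpoint_ne (e : Edge k ℓ) : e.endpoint false ≠ e.endpoint true := by
  have hc' : ∀ c : Corner, c ≠ c + 1 := by decide
  rcases e with ((c | c) | ⟨i, (⟨j, c⟩ | ⟨j, c⟩)⟩ | ⟨i, (n | s | s | s)⟩) <;>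
  simp [Edge.endpoint, outermost, innermost, before, after, hc']

theorem edgeSet_spanningGraph (X : Set (Edge k ℓ)) :
    (spanningGraph X).edgeSet = Edge.ends '' X := by
  rw [spanningGraph, SimpleGraph.edgeSet_fromEdgeSet]
  refine Disjoint.sdiff_eq_left (Set.disjoint_left.2 ?_)
  rintro _ ⟨e, -, rfl⟩ h
  exact e.endpoint_ne h

theorem mem_edgeSet_spanningGraph {X : Set (Edge k ℓ)} {e : Edge k ℓ} (he : e ∈ X) :
    e.ends ∈ (spanningGraph X).edgeSet := by
  rw [edgeSet_spanningGraph]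
  exact Set.mem_image_of_mem _ he

theorem spanningGraph_mono {X Y : Set (Edge k ℓ)} (h : X ⊆ Y) :
    spanningGraph X ≤ spanningGraph Y :=
  SimpleGraph.fromEdgeSet_mono (Set.image_mono h)

theorem card_SEdge : Fintype.card SEdge = 8 := by decide
theorem card_BEdge : Fintype.card BEdge = 8 := by decide

theorem card_AEdge : Fintype.card (AEdge k) = 8 * k - 4 := by
  have := NeZero.pos k
  rw [Fintype.card_congr (AEdge.equivSum k)]
  simp
  omega

theorem card_Edge : Nat.card (Edge k ℓ) = ℓ * (8 * k + 4) := by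
  obtain ⟨m, rfl⟩ := Nat.exists_eq_succ_of_ne_zero (NeZero.ne ℓ)
  obtain ⟨n, rfl⟩ := Nat.exists_eq_succ_of_ne_zero (NeZero.ne k)
  rw [Nat.card_eq_fintype_card, Fintype.card_congr (Edge.equivSum _ _)]
  simp only [Fintype.card_sum, Fintype.card_prod, card_SEdge, card_BEdge, card_AEdge,
    Fintype.card_fin]
  simp only [Nat.succ_eq_add_one, Nat.add_sub_cancel, show 8 * (n + 1) - 4 = 8 * n + 4 by omega]
  ring

theorem ncard_edgeSet_graph : (graph k ℓ).edgeSet.ncard = ℓ * (8 * k + 4) := by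
  rw [graph, edgeSet_spanningGraph, Set.ncard_image_of_injective _ Edge.ends_injective,
    Set.ncard_univ, card_Edge]

end
end Skeleton

/-! ### The sets `E_c`: central symmetry and size -/

namespace Skeleton

section
variable {k ℓ : ℕ}

theorem square_not (p : Bool) (d : Corner) : square (!p) d = square p (d + 2) := by
  revert p d; decide

theorem square_xor (q p : Bool) (d : Corner) :
    square (q ^^ p) d = square p (bif q then d + 2 else d) := by
  revert q p d; decide

theorem parity_succ (i : Fin ℓ) (j : ℕ) (h : j + 1 < k) :
    parity i (⟨j, by omega⟩ : Fin k) = !parity i (⟨j + 1, h⟩ : Fin k) := by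
  simp only [parity]
  rw [show k - j = (k - (j + 1)) + 1 by omega, ← add_assoc, Nat.bodd_succ]

theorem parity_eq_xor [NeZero ℓ] (i : Fin ℓ) (j : Fin k) :
    parity i j = (Nat.bodd (i * k) ^^ parity (⟨0, Nat.pos_of_ne_zero (NeZero.ne ℓ)⟩ : Fin ℓ) j) := by
  simp [parity, Nat.bodd_add]

theorem Labelling.inA_side_mem_edgesOf (D : Labelling) (c : Colour) (i : Fin ℓ) (j : Fin k)
    (d : Corner) : Edge.inA i (.side j d) ∈ D.edgesOf c ↔
      square (parity i j) d = c ∨ square (parity i j) (d + 1) = c := by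
  simp [edgesOf, halfColour]

theorem Labelling.inA_spoke_mem_edgesOf (D : Labelling) (c : Colour) (i : Fin ℓ)
    (j : Fin (k - 1)) (d : Corner) : Edge.inA i (.spoke j d) ∈ D.edgesOf c ↔
      square (parity i (⟨j + 1, by omega⟩ : Fin k)) d = c ∨
      square (!parity i (⟨j + 1, by omega⟩ : Fin k)) d = c := by
  rw [← parity_succ]
  simp [edgesOf, halfColour]

/-- Block `i` starts `i * k` squares further in, so its colours are exchanged exactly when `i * k`
is odd, and exchanging the two colourings amounts to a half-turn. -/
theorem Labelling.identify_mem_edgesOf [NeZero ℓ] (D : Labelling) (c : Colour) (i : Fin ℓ)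
    (e : AEdge k) :
    Edge.inA (⟨0, Nat.pos_of_ne_zero (NeZero.ne ℓ)⟩ : Fin ℓ)
      (bif Nat.bodd (i * k) then e.reflect else e) ∈ D.edgesOf c ↔
    Edge.inA i e ∈ D.edgesOf c := by
  have h4 : ∀ d : Corner, d + 2 + 1 = d + 1 + 2 := by decide
  rcases e with ⟨j, d⟩ | ⟨j, d⟩
  · rw [inA_side_mem_edgesOf, parity_eq_xor, square_xor, square_xor]
    cases Nat.bodd (i * k) <;> simp [AEdge.reflect, inA_side_mem_edgesOf, h4]
  · rw [inA_spoke_mem_edgesOf, parity_eq_xor i, ← Bool.xor_not, square_xor, square_xor]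
    cases Nat.bodd (i * k) <;> simp [AEdge.reflect, inA_spoke_mem_edgesOf]

/-- The edges of a block `B` having a half-edge of a given colour. -/
theorem BChoice.sum_halfColour (D : BChoice) (p : Bool) (c : Colour) :
    (∑ e, if ∃ b, D.halfColour p e b = c then 1 else 0) = 4 := by
  obtain ⟨mid, extra, swap, h⟩ := D
  revert p c
  revert mid extra swap
  decide +kernel

/-- After a swap, an outer half with `mid s = false` would carry its special colour at the
subdivision vertex; `mid_of_swap` excludes this. -/
theorem BChoice.special_ne (D : BChoice) (p : Bool) (e : BEdge) (b : Bool) :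
    D.special p e ≠ D.halfColour p e b := by
  obtain ⟨mid, extra, swap, h⟩ := D
  revert p e b
  revert mid extra swap
  decide +kernel

theorem BChoice.halfColour_ne (D : BChoice) (p : Bool) (e : BEdge) :
    D.halfColour p e false ≠ D.halfColour p e true := by
  obtain ⟨mid, extra, swap, h⟩ := D
  revert p e
  revert mid extra swap
  decide +kernel

theorem SEdge.sum_halfColour (c : Colour) :
    (∑ e : SEdge, if ∃ b, e.halfColour b = c then 1 else 0) = 4 := by
  revert c
  decide +kernel

theorem SEdge.halfColour_ne (e : SEdge) : e.halfColour false ≠ e.halfColour true := by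
  revert e
  decide

open scoped Classical in
-- Two sides of each of the `k` layers and two spokes between consecutive layers lie in `E_c`: `2 *
-- k + 2 * (k - 1)`.
theorem Labelling.sum_inA_mem_edgesOf [NeZero k] (D : Labelling) (c : Colour) (i : Fin ℓ) :
    (∑ e : AEdge k, if Edge.inA i e ∈ D.edgesOf c then 1 else 0) + 2 = 4 * k := by
  have h1 : ∀ p c, (∑ d, if square p d = c ∨ square p (d + 1) = c then 1 else 0) = 2 := by
    decide
  have h2 : ∀ p c, (∑ d, if square p d = c ∨ square (!p) d = c then 1 else 0) = 2 := by
    decide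
  have := NeZero.pos k
  simp only [AEdge.sum_eq, inA_side_mem_edgesOf, inA_spoke_mem_edgesOf]
  have h3 : ∀ j : Fin k, (∑ d, if square (parity i j) d = c ∨ square (parity i j) (d + 1) = c
      then 1 else 0) = 2 := fun j => by convert h1 (parity i j) c
  have h4 : ∀ p, (∑ d, if square p d = c ∨ square (!p) d = c then 1 else 0) = 2 :=
    fun p => by convert h2 p c
  simp only [h3, h4]
  simp
  omega

/-- Four edges come from `S`, four from each of the `ℓ - 1` blocks `B`, and `4 * k - 2` from each
block `A`. -/
theorem ncard_edgesOf [NeZero k] [NeZero ℓ] (D : Labelling) (c : Colour) :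
    (D.edgesOf c : Set (Edge k ℓ)).ncard = ℓ * (4 * k + 2) := by
  classical
  have hA := fun i : Fin ℓ => D.sum_inA_mem_edgesOf (k := k) c i
  have hS := SEdge.sum_halfColour c
  have hB := fun i : Fin (ℓ - 1) => (D.choice (parityB k i)).sum_halfColour (parityB k i) c
  have hX : (D.edgesOf c : Set (Edge k ℓ)).toFinset = Finset.univ.filter (· ∈ D.edgesOf c) := by
    ext; simp
  rw [Set.ncard_eq_toFinset_card', hX, Finset.card_filter, Edge.sum_eq]
  have hS' : (∑ e : SEdge, if (Edge.inS e : Edge k ℓ) ∈ D.edgesOf c then 1 else 0) = 4 := by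
    rw [← hS]; congr!
  have hB' : ∀ i, (∑ e, if (Edge.inB i e : Edge k ℓ) ∈ D.edgesOf c then 1 else 0) = 4 := by
    intro i; rw [← hB i]; congr!
  have hA' : ∀ i, (∑ e : AEdge k, if (Edge.inA i e : Edge k ℓ) ∈ D.edgesOf c then 1 else 0)
    = 4 * k - 2 := fun i => by have := hA i; omega
  simp only [hS', hB', hA']
  obtain ⟨m, rfl⟩ := Nat.exists_eq_succ_of_ne_zero (NeZero.ne ℓ)
  obtain ⟨n, rfl⟩ := Nat.exists_eq_succ_of_ne_zero (NeZero.ne k)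
  simp [show 4 * (n + 1) - 2 = 4 * n + 2 by omega]
  ring

theorem AEdge.reflect_reflect (e : AEdge k) : e.reflect.reflect = e := by
  have h4 : ∀ d : Corner, d + 2 + 2 = d := by decide
  rcases e with ⟨j, d⟩ | ⟨j, d⟩ <;> simp [reflect, h4]

/-- There is one copy per block `A`, or one in `S` and one per block `B`. An upper bound is enough,
as connectedness forces the reverse count. -/
theorem ncard_identify_le [NeZero ℓ] (D : Labelling) (x : SEdge ⊕ AEdge k) :
    {e : Edge k ℓ | D.identify e = x}.ncard ≤ ℓ := by
  have hℓ := NeZero.pos ℓ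
  rcases x with s | a
  · refine (Set.ncard_le_ncard (t := insert (.inS s) ((fun i : Fin (ℓ - 1) =>
      Edge.inB i ((D.label (parityB k i)).symm s)) '' Set.univ)) ?_ (Set.toFinite _)).trans
      ((Set.ncard_insert_le _ _).trans ?_)
    · rintro (e | ⟨i, e⟩ | ⟨i, e⟩) h
      · simpa [Labelling.identify] using h
      · simp [Labelling.identify] at h
      · right
        refine ⟨i, trivial, ?_⟩
        simp only [Labelling.identify, Set.mem_ofPred_eq, Sum.inl.injEq] at h
        simp [← h]
    · have := Set.ncard_image_le (f := fun i : Fin (ℓ - 1) =>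
        (Edge.inB i ((D.label (parityB k i)).symm s) : Edge k ℓ)) (Set.toFinite Set.univ)
      simp at this ⊢
      omega
  · refine (Set.ncard_le_ncard (t := (fun i : Fin ℓ =>
      Edge.inA i (bif Nat.bodd (i * k) then a.reflect else a)) '' Set.univ) ?_
      (Set.toFinite _)).trans ((Set.ncard_image_le (Set.toFinite _)).trans (by simp))
    rintro (e | ⟨i, e⟩ | ⟨i, e⟩) h
    · simp [Labelling.identify] at h
    · refine ⟨i, trivial, ?_⟩
      simp only [Labelling.identify, Set.mem_ofPred_eq, Sum.inr.injEq] at h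
      rw [← h]
      dsimp only
      generalize Nat.bodd (i * k) = q
      cases q <;> simp only [cond_true, cond_false, AEdge.reflect_reflect]
    · simp [Labelling.identify] at h

end
end Skeleton

/-! ### Finite checks in the blocks `B` and `S` -/

namespace Skeleton

/-- The values at the ends of the edges of a block `B` with outer square `square p` of a function
that is true on the outer square and, on the inner square, equals `u p` at the corner of colour `c`
of `square p` and `u (!p)` at the three other corners. -/
def BEdge.value (p : Bool) (c : Colour) (u : Bool → Bool) (m : South → Bool) (r : Bool) :
    BEdge → Bool → Bool
  | .plain n, b => bif b then u (if square p n.corner = c then p else !p) else true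
  | .outerHalf s, b => bif b then m s else true
  | .innerHalf s, b => bif b then u (if square p s.corner = c then p else !p) else m s
  | .extra s, b => bif b then u (if square p s.corner = c then p else !p) else r

-- The inward step. Five pieces have to be attached to the outer square: the three vertices of
-- degree two and the two trees of the next block `A`. `E_c` supplies four edges; the fifth is the
-- special edge, unless the two trees are already joined inside `A`.
set_option synthInstance.maxHeartbeats 400000 in
set_option synthInstance.maxSize 2000 in
theorem BChoice.connects (D : BChoice) (p : Bool) (c : Colour) (u : Bool → Bool)
    (m : South → Bool) (r : Bool)
    (h : ∀ e, (∃ b, D.halfColour p e b = c) →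
      BEdge.value p c u m r e false = BEdge.value p c u m r e true)
    (h' : u false = u true ∨ ∃ e, D.special p e = c ∧
      BEdge.value p c u m r e false = BEdge.value p c u m r e true) :
    (∀ q, u q = true) ∧ (∀ s, m s = true) ∧ r = true := by
  obtain ⟨mid, extra, swap, hs⟩ := D
  revert mid extra swap p c u m r
  decide +kernel

/-- The values at the ends of the edges of the starting block of a function that equals `f` on the
outer square and, on the inner one, `u false` at the corner of colour `c` of `square false` and
`u true` at the three other corners. -/
def SEdge.value (c : Colour) (u : Bool → Bool) (f : Corner → Bool) : SEdge → Bool → Bool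
  | .side d, b => f (bif b then d + 1 else d)
  | .spoke d, b => bif b then u (if square false d = c then false else true) else f d

/-- The start of the induction: six pieces (four outer corners, two trees), four edges of `E_c` and
one further connection. Any edge of `S` without colour `c` will do, so of the special edge only
`special_ne` is needed. -/
theorem SEdge.connects (c : Colour) (u : Bool → Bool) (f : Corner → Bool) (h0 : f 0 = true)
    (h : ∀ e : SEdge, (∃ b, e.halfColour b = c) → e.value c u f false = e.value c u f true)
    (h' : u false = u true ∨ ∃ e : SEdge, (∀ b, c ≠ e.halfColour b) ∧
      e.value c u f false = e.value c u f true) :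
    (∀ q, u q = true) ∧ ∀ d, f d = true := by
  revert c u f
  decide +kernel
end Skeleton

/-! ### Every `T_{c,x}` is a spanning tree -/

namespace Skeleton

section
variable {k ℓ : ℕ} [NeZero k]

theorem parity_outermost_zero [NeZero ℓ] :
    parity (⟨0, Nat.pos_of_ne_zero (NeZero.ne ℓ)⟩ : Fin ℓ)
      (⟨k - 1, Nat.sub_one_lt (NeZero.ne k)⟩ : Fin k) = true := by
  have := NeZero.pos k
  simp [parity, show k - (k - 1) = 1 by omega]

theorem parity_outermost_after (i : Fin (ℓ - 1)) :
    parity (after i) (⟨k - 1, Nat.sub_one_lt (NeZero.ne k)⟩ : Fin k) = !parityB k i := by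
  have := NeZero.pos k
  simp only [parity, parityB, after, show k - (k - 1) = 1 by omega]
  rw [Nat.bodd_succ]

variable [NeZero ℓ]

/-- A function that is constant along the edges of `E_c` takes at most two values on a block `A`,
one on each of the two trees that `E_c` induces there. -/
theorem Labelling.exists_layer_eq (D : Labelling) (c : Colour) (P : Vert k ℓ → Bool)
    (h : ∀ e ∈ D.edgesOf c, P (e.endpoint false) = P (e.endpoint true)) (i : Fin ℓ) :
    ∃ u : Bool → Bool, ∀ j d, P (.layer i j d) =
      u (if square (!parity i j) d = c then !parity i j else parity i j) := by
  -- `κ q` is the corner of colour `c` in `square q`; the corners `κ false` and `κ true` are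
  -- opposite.
  have hκ : ∀ c, ∃ κ : Bool → Corner, ∀ q d, square q d = c ↔ d = κ q := by decide +kernel
  have h2 : ∀ d : Corner, d + 2 + 2 = d := by decide
  have h4 : ∀ d e : Corner, d ≠ e + 2 → d = e ∨ d = e + 1 ∨ d + 1 = e := by decide
  obtain ⟨κ, hκ⟩ := hκ c
  have hnot : ∀ q, κ (!q) = κ q + 2 := fun q =>
    ((hκ _ _).1 (by rw [square_not, h2, hκ])).symm
  -- Every spoke at `κ q` has colour `c` at one end, as the colourings alternate; so each of these
  -- two columns lies in one tree.
  have hcol : ∀ (n : ℕ) (hn : n < k) (q : Bool),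
      P (.layer i ⟨n, hn⟩ (κ q)) = P (innermost i (κ q)) := by
    intro n
    induction n with
    | zero => intro _ _; rfl
    | succ n ih =>
      intro hn q
      rw [← ih (by omega) q]
      refine h (.inA i (.spoke ⟨n, by omega⟩ (κ q))) ?_
      rw [D.inA_spoke_mem_edgesOf, hκ, hκ]
      generalize parity i _ = p
      cases p <;> cases q <;> simp
  refine ⟨fun q => P (innermost i (κ q)), fun j d => ?_⟩
  split_ifs with hd
  · rw [(hκ _ _).1 hd]
    exact hcol j j.2 _
  · dsimp only
    rw [← hcol j j.2 (parity i j)]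
    rw [hκ, hnot] at hd
    -- A corner not opposite to the one of colour `c` is that corner or its neighbour along a side
    -- in `E_c`.
    rcases h4 _ _ hd with h' | h' | h'
    · rw [h']
    · have := h (.inA i (.side j (κ (parity i j))))
        ((D.inA_side_mem_edgesOf c i j _).2 (Or.inl ((hκ _ _).2 rfl)))
      rw [h']
      exact this.symm
    · have := h (.inA i (.side j d)) ((D.inA_side_mem_edgesOf c i j _).2 (Or.inr ((hκ _ _).2 h')))
      rw [← h']
      exact this

/-- Every edge of a block `A` outside `E_c` joins the two trees that `E_c` induces there. -/
theorem Labelling.eq_of_notMem_edgesOf (D : Labelling) (c : Colour) (P : Vert k ℓ → Bool)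
    (i : Fin ℓ) (u : Bool → Bool) (hu : ∀ j d, P (.layer i j d) =
      u (if square (!parity i j) d = c then !parity i j else parity i j))
    (e : AEdge k) (he : Edge.inA i e ∉ D.edgesOf c)
    (h : P ((Edge.inA i e).endpoint false) = P ((Edge.inA i e).endpoint true)) :
    u false = u true := by
  -- A side avoiding `c` has exactly one end opposite to the corner of colour `c`. A spoke outside
  -- `E_c` avoids both columns, so each end lies in the tree of its own layer's colouring, and these
  -- alternate.
  have hsq : ∀ p d c, square p d ≠ c → square p (d + 1) ≠ c →
      (square (!p) d = c ∧ square (!p) (d + 1) ≠ c) ∨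
      (square (!p) d ≠ c ∧ square (!p) (d + 1) = c) := by decide
  rcases e with ⟨j, d⟩ | ⟨j, d⟩
  · rw [D.inA_side_mem_edgesOf, not_or] at he
    simp only [Edge.endpoint, cond_true, cond_false, hu] at h
    revert h he
    generalize parity i j = p
    intro he h
    rcases hsq p d c he.1 he.2 with h' | h' <;> cases p <;> simp_all
  · rw [D.inA_spoke_mem_edgesOf, not_or] at he
    simp only [Edge.endpoint, cond_true, cond_false, hu] at h
    rw [parity_succ i j (by omega)] at h
    revert h he
    generalize parity i _ = p
    intro he h
    cases p <;> simp_all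

theorem Labelling.tree_connected (D : Labelling) (t : D.Index k ℓ) :
    (D.tree k ℓ t).Connected := by
  obtain ⟨⟨c, x⟩, hx⟩ := t
  refine SimpleGraph.connected_of_forall_bool (.outer 0) fun P hP h0 => ?_
  have hX : ∀ e : Edge k ℓ, e ∈ D.edgesOf c ∨ D.identify e = x →
      P (e.endpoint false) = P (e.endpoint true) := by
    intro e he
    exact hP _ _ (mem_edgeSet_spanningGraph (X := D.edgesOf c ∪ {e | D.identify e = x}) he)
  choose u hu using D.exists_layer_eq c P fun e he => hX e (Or.inl he)
  -- If `x` lies in `A`, its copy in each block is outside `E_c` and joins the two trees there.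
  have hjoin : ∀ a, x = .inr a → ∀ i, u i false = u i true := by
    rintro a rfl i
    refine D.eq_of_notMem_edgesOf c P i (u i) (hu i)
      (bif Nat.bodd (i * k) then a.reflect else a) ?_ (hX _ (Or.inr ?_))
    · rw [← D.identify_mem_edgesOf]
      generalize Nat.bodd (i * k) = q
      cases q <;> simpa [Labelling.Admissible, AEdge.reflect_reflect] using hx
    · simp only [Labelling.identify]
      generalize Nat.bodd (i * k) = q
      cases q <;> simp [AEdge.reflect_reflect]
  have hSv : ∀ (e : SEdge) (b : Bool), e.value c (u ⟨0, NeZero.pos ℓ⟩) (fun d => P (.outer d)) b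
      = P ((Edge.inS e : Edge k ℓ).endpoint b) := by
    rintro (d | d) (_ | _)
    iterate 3 rfl
    change _ = P (.layer _ _ d)
    rw [hu, parity_outermost_zero]
    rfl
  have hS := SEdge.connects c (u ⟨0, NeZero.pos ℓ⟩) (fun d => P (.outer d)) h0
    (fun e he => by rw [hSv, hSv]; exact hX _ (Or.inl he)) (by
      rcases x with s | a
      · right
        refine ⟨s, fun b => ?_, by rw [hSv, hSv]; exact hX _ (Or.inr rfl)⟩
        rw [← show D.special s = c from hx]
        exact D.special_ne s b
      · exact Or.inl (hjoin a rfl _))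
  have hB : ∀ i : Fin (ℓ - 1), (∀ q, u (before i) q = true) →
      (∀ q, u (after i) q = true) ∧ (∀ s, P (.mid i s) = true) ∧ P (.extra i) = true := by
    intro i hi
    have hv : ∀ (e : BEdge) (b : Bool), e.value (parityB k i) c (u (after i))
        (fun s => P (.mid i s)) (P (.extra i)) b = P ((Edge.inB i e : Edge k ℓ).endpoint b) := by
      rintro (d | d | d | d) (_ | _) <;>
      simp [BEdge.value, Edge.endpoint, outermost, innermost, hu, hi, parity_outermost_after]
    refine (D.choice (parityB k i)).connects (parityB k i) c (u (after i)) _ _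
      (fun e he => by rw [hv, hv]; exact hX _ (Or.inl he)) ?_
    rcases x with s | a
    · right
      refine ⟨(D.label (parityB k i)).symm s, ?_, ?_⟩
      · rw [← D.special_label, Equiv.apply_symm_apply]
        exact hx
      · rw [hv, hv]
        exact hX _ (Or.inr (by simp [Labelling.identify]))
    · exact Or.inl (hjoin a rfl _)
  have hA : ∀ (n : ℕ) (hn : n < ℓ) (q : Bool), u ⟨n, hn⟩ q = true := by
    intro n
    induction n with
    | zero => exact fun _ => hS.1
    | succ n ih => exact fun hn => (hB ⟨n, by omega⟩ (ih (by omega))).1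
  rintro (d | ⟨i, j, d⟩ | ⟨i, s⟩ | i)
  · exact hS.2 d
  · rw [hu]
    exact hA i i.2 _
  · exact (hB i (hA i (by omega))).2.1 s
  · exact (hB i (hA i (by omega))).2.2

/-- Connected, with at most `ℓ * (4 * k + 2) + ℓ` edges, one fewer than the number of vertices. -/
theorem Labelling.tree_isTree (D : Labelling) (t : D.Index k ℓ) : (D.tree k ℓ t).IsTree := by
  refine SimpleGraph.isTree_iff_connected_and_card.2 ⟨D.tree_connected t, le_antisymm ?_
    (D.tree_connected t).card_vert_le_card_edgeSet_add_one⟩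
  rw [Vert.card_eq, Nat.card_coe_set_eq, Labelling.tree, edgeSet_spanningGraph]
  have h1 := Set.ncard_image_le (f := Edge.ends)
    (Set.toFinite (D.edgesOf t.1.1 ∪ {e : Edge k ℓ | D.identify e = t.1.2}))
  have h2 := Set.ncard_union_le (D.edgesOf t.1.1) {e : Edge k ℓ | D.identify e = t.1.2}
  have h3 := ncard_identify_le (ℓ := ℓ) D t.1.2
  rw [ncard_edgesOf] at h2
  nlinarith

end
end Skeleton

/-! ### Weights and covering -/

namespace Skeleton

theorem Labelling.halfColour_ne {k ℓ : ℕ} (D : Labelling) (e : Edge k ℓ) :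
    D.halfColour e false ≠ D.halfColour e true := by
  have h1 : ∀ p d, square p d ≠ square p (d + 1) := by decide
  have h2 : ∀ p d, square p d ≠ square (!p) d := by decide
  rcases e with e | ⟨i, ⟨j, d⟩ | ⟨j, d⟩⟩ | ⟨i, e⟩
  · exact e.halfColour_ne
  · exact h1 _ _
  · simp only [halfColour, cond_true, cond_false]
    rw [parity_succ i j (by omega)]
    exact h2 _ _
  · exact (D.choice _).halfColour_ne _ e

theorem Labelling.mem_edgesOf_iff {k ℓ : ℕ} (D : Labelling) (c : Colour) (e : Edge k ℓ) :
    e ∈ D.edgesOf c ↔ c = D.halfColour e false ∨ c = D.halfColour e true := by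
  simp [edgesOf, eq_comm]

theorem sum_colour_eq_of_ne {a b : Colour} (h : a ≠ b) (W z : ℝ) :
    (∑ c, if c = a ∨ c = b then W else z) = 2 * W + 2 * z := by
  rw [show (Finset.univ : Finset Colour) = {.blue, .red, .green, .black} from rfl]
  cases a <;> cases b <;> first | exact absurd rfl h | (simp; ring)

theorem sum_colour_eq_of_ne_of_ne {a b s : Colour} (h : a ≠ b) (ha : s ≠ a) (hb : s ≠ b)
    (p : Colour → Prop) [DecidablePred p] (hp : ∀ c, p c ↔ s = c) (W z : ℝ) :
    (∑ c, if c = a ∨ c = b then W else if p c then z else 0) = 2 * W + z := by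
  simp only [hp]
  rw [show (Finset.univ : Finset Colour) = {.blue, .red, .green, .black} from rfl]
  cases a <;> cases b <;> first
    | exact absurd rfl h
    | (cases s <;> first | exact absurd rfl ha | exact absurd rfl hb | (simp; ring))

section
variable {k ℓ : ℕ}

/-- The weight of the trees `T_{c,x}`, which depends on `x` only. -/
noncomputable def weightOf (k : ℕ) : SEdge ⊕ AEdge k → ℝ
  | .inl _ => 2 / (8 * (k : ℝ) + 6)
  | .inr _ => 1 / (8 * (k : ℝ) + 6)

theorem weightOf_pos (x : SEdge ⊕ AEdge k) : 0 < weightOf k x := by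
  cases x <;> simp only [weightOf] <;> positivity

variable [NeZero ℓ]

theorem Labelling.weight_eq (D : Labelling) (t : D.Index k ℓ) :
    D.weight k ℓ t = weightOf k t.1.2 := by
  obtain ⟨⟨c, s | a⟩, h⟩ := t <;> rfl

open scoped Classical in
theorem Labelling.sum_index (D : Labelling) (f : Colour → SEdge ⊕ AEdge k → ℝ) :
    ∑ t : D.Index k ℓ, f t.1.1 t.1.2 = ∑ c, ∑ x, if D.Admissible ℓ c x then f c x else 0 := by
  rw [← Finset.sum_subtype (Finset.univ.filter fun t : Colour × (SEdge ⊕ AEdge k) =>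
    D.Admissible ℓ t.1 t.2) (by simp) (fun t => f t.1 t.2), Finset.sum_filter,
    Fintype.sum_prod_type]

variable [NeZero k]

open scoped Classical in
-- Two special edges of weight `2 / N` and `(8 * k - 4) - (4 * k - 2)` edges of `A` of weight `1 /
-- N`, with `N = 8 * k + 6`.
theorem Labelling.sum_weightOf (D : Labelling) (c : Colour) :
    (∑ x : SEdge ⊕ AEdge k, if D.Admissible ℓ c x then weightOf k x else 0) =
      (4 * (k : ℝ) + 2) / (8 * (k : ℝ) + 6) := by
  have hN : (8 * (k : ℝ) + 6) ≠ 0 := by positivity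
  have hk := NeZero.pos k
  have hS := D.special_two c
  rw [Fintype.card_subtype] at hS
  have hA := D.sum_inA_mem_edgesOf (k := k) c (⟨0, NeZero.pos ℓ⟩ : Fin ℓ)
  rw [← Finset.card_filter] at hA
  have hA' := Finset.card_filter_add_card_filter_not (s := (Finset.univ : Finset (AEdge k)))
    (fun e => Edge.inA (⟨0, NeZero.pos ℓ⟩ : Fin ℓ) e ∈ D.edgesOf c)
  rw [Finset.card_univ, card_AEdge] at hA'
  have hA2 : (((Finset.univ : Finset (AEdge k)).filter fun e =>
      Edge.inA (⟨0, NeZero.pos ℓ⟩ : Fin ℓ) e ∉ D.edgesOf c).card : ℝ) + 2 = 4 * k := by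
    exact_mod_cast (by omega)
  rw [Fintype.sum_sum_type]
  have hS' : (Finset.univ.filter fun s : SEdge =>
      D.Admissible ℓ c (.inl s : SEdge ⊕ AEdge k)).card = 2 := by
    rw [← hS]
    congr!
  have hA3 : ((Finset.univ.filter fun a : AEdge k =>
      D.Admissible ℓ c (.inr a : SEdge ⊕ AEdge k)).card : ℝ) = 4 * k - 2 := by
    rw [← eq_sub_of_add_eq hA2]
    congr!
  simp only [weightOf]
  rw [← Finset.sum_filter, ← Finset.sum_filter, Finset.sum_const, Finset.sum_const, nsmul_eq_mul,
    nsmul_eq_mul, hS', hA3]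
  field_simp
  push_cast
  ring

theorem Labelling.sum_weight (D : Labelling) :
    ∑ t, D.weight k ℓ t = (16 * (k : ℝ) + 8) / (8 * (k : ℝ) + 6) := by
  simp only [D.weight_eq]
  rw [D.sum_index fun _ x => weightOf k x]
  simp only [D.sum_weightOf]
  simp [show Fintype.card Colour = 4 from rfl]
  ring

open scoped Classical in
theorem Labelling.one_le_sum_weight (D : Labelling) (e : Edge k ℓ) :
    1 ≤ ∑ t with e.ends ∈ (D.tree k ℓ t).edgeSet, D.weight k ℓ t := by
  have hN : (8 * (k : ℝ) + 6) ≠ 0 := by positivity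
  set W : ℝ := (4 * (k : ℝ) + 2) / (8 * (k : ℝ) + 6) with hW
  -- Sorted by colour: if `e` is in `E_c`, all trees of colour `c` contain it; otherwise only the
  -- one with `x = D.identify e` can.
  calc (1 : ℝ) ≤ ∑ c, if e ∈ D.edgesOf c then W else
        if D.Admissible ℓ c (D.identify e) then weightOf k (D.identify e) else 0 := by
        simp only [D.mem_edgesOf_iff]
        rcases e with e | ⟨i, e⟩ | ⟨i, e⟩
        · refine le_of_eq ((sum_colour_eq_of_ne_of_ne (D.halfColour_ne (.inS e : Edge k ℓ))
            (D.special_ne e false) (D.special_ne e true)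
            (fun c => D.Admissible ℓ c (D.identify (.inS e : Edge k ℓ))) (fun _ => Iff.rfl) W _).trans
            ?_).symm
          simp only [identify, weightOf, hW]
          field_simp
          ring
        · simp only [identify, Admissible, D.identify_mem_edgesOf, D.mem_edgesOf_iff]
          refine le_of_eq (Eq.trans ?_ ((sum_colour_eq_of_ne (D.halfColour_ne (.inA i e))
            W (1 / (8 * (k : ℝ) + 6))).trans ?_)).symm
          · refine Finset.sum_congr rfl fun c _ => ?_
            split_ifs <;> rfl
          · rw [hW]
            field_simp
            ring
        · refine le_of_eq ((sum_colour_eq_of_ne_of_ne (D.halfColour_ne (.inB i e))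
            (s := D.special (D.label (parityB k i) e)) ?_ ?_
            (fun c => D.Admissible ℓ c (D.identify (.inB i e))) (fun _ => Iff.rfl) W _).trans ?_).symm
          · rw [D.special_label]
            exact (D.choice _).special_ne _ e false
          · rw [D.special_label]
            exact (D.choice _).special_ne _ e true
          · simp only [identify, weightOf, hW]
            field_simp
            ring
    _ ≤ ∑ c, ∑ x, if D.Admissible ℓ c x then
        (if e ∈ D.edgesOf c ∨ D.identify e = x then weightOf k x else 0) else 0 := by
        refine Finset.sum_le_sum fun c _ => ?_
        split_ifs with h1 h2
        · simp only [h1, true_or, if_true]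
          rw [D.sum_weightOf]
        · refine le_trans (le_of_eq ?_) (Finset.single_le_sum
            (f := fun x => if D.Admissible ℓ c x then
              (if e ∈ D.edgesOf c ∨ D.identify e = x then weightOf k x else 0) else 0)
            (fun x _ => ?_) (Finset.mem_univ (D.identify e)))
          · simp [h2]
          · split_ifs <;> first | exact le_rfl | exact (weightOf_pos x).le
        · refine Finset.sum_nonneg fun x _ => ?_
          split_ifs <;> first | exact le_rfl | exact (weightOf_pos x).le
    _ = ∑ t : D.Index k ℓ, if e ∈ D.edgesOf t.1.1 ∨ D.identify e = t.1.2 then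
        weightOf k t.1.2 else 0 :=
        (D.sum_index fun c x => if e ∈ D.edgesOf c ∨ D.identify e = x then weightOf k x else 0).symm
    _ ≤ ∑ t with e.ends ∈ (D.tree k ℓ t).edgeSet, D.weight k ℓ t := by
        rw [Finset.sum_filter]
        refine Finset.sum_le_sum fun t _ => ?_
        rw [D.weight_eq]
        by_cases h : e ∈ D.edgesOf t.1.1 ∨ D.identify e = t.1.2
        · rw [if_pos h, if_pos]
          exact mem_edgeSet_spanningGraph
            (X := D.edgesOf t.1.1 ∪ {e | D.identify e = t.1.2}) h
        · rw [if_neg h]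
          split_ifs <;> first | exact le_rfl | exact (weightOf_pos _).le

/-! ### The arborization and the fractional arboricity -/

theorem Labelling.isArborization (D : Labelling) :
    IsArborization (graph k ℓ) ((16 * (k : ℝ) + 8) / (8 * (k : ℝ) + 6))
      (D.tree k ℓ) (D.weight k ℓ) where
  pos := by positivity
  weight_pos t := by
    rw [D.weight_eq]
    exact weightOf_pos _
  le _ := spanningGraph_mono (Set.subset_univ _)
  acyclic t := (D.tree_isTree t).isAcyclic
  cover x hx := by
    rw [graph, edgeSet_spanningGraph] at hx
    obtain ⟨e, -, rfl⟩ := hx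
    exact D.one_le_sum_weight e
  total := D.sum_weight

theorem isFractionalArboricity_graph :
    IsFractionalArboricity (graph k ℓ) ((16 * (k : ℝ) + 8) / (8 * (k : ℝ) + 6)) := by
  have hℓ := NeZero.pos ℓ
  have hℓ' : (ℓ : ℝ) ≠ 0 := by positivity
  constructor
  · refine ⟨⊤, ?_, ?_⟩
    · rw [SimpleGraph.Subgraph.verts_top, Set.ncard_univ, Vert.card_eq]
      nlinarith
    · rw [SimpleGraph.Subgraph.verts_top, Set.ncard_univ, Vert.card_eq,
        SimpleGraph.Subgraph.edgeSet_top, ncard_edgeSet_graph]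
      push_cast
      rw [add_sub_cancel_right, mul_div_mul_left _ _ hℓ', div_eq_div_iff (by positivity)
        (by positivity)]
      ring
  · rintro _ ⟨S, hS, rfl⟩
    -- The upper bound needs some arborization, hence the existence of a labelling.
    obtain ⟨D⟩ := labelling_nonempty
    have hS' : (2 : ℝ) ≤ S.verts.ncard := by exact_mod_cast hS
    rw [div_le_iff₀ (by linarith)]
    exact (D.isArborization (k := k) (ℓ := ℓ)).ncard_edgeSet_le S
      (Set.nonempty_of_ncard_ne_zero (by omega))

end
end Skeleton

theorem mainTheorem11 (k ℓ : ℕ) [NeZero k] [NeZero ℓ] (g : ℕ) (hg : g = 8 * k + 4) :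
    (∀ D : Skeleton.Labelling,
      (∀ t : D.Index k ℓ, (D.tree k ℓ t).IsTree) ∧
      IsArborization (Skeleton.graph k ℓ) ((16 * (k : ℝ) + 8) / (8 * (k : ℝ) + 6))
        (D.tree k ℓ) (D.weight k ℓ)) ∧
    IsFractionalArboricity (Skeleton.graph k ℓ) (2 * (g : ℝ) / ((g : ℝ) + 2)) := by
  refine ⟨fun D => ⟨D.tree_isTree, D.isArborization⟩, ?_⟩
  subst hg
  convert Skeleton.isFractionalArboricity_graph (k := k) (ℓ := ℓ) using 1
  push_cast
  congr 1 <;> ring
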